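/- Let $d\ge 0$ be an integer and let $\mathcal X,\mathcal Y,\mathcal Z$ be finite non-empty alphabets, $\mathcal X=\{0,\dots,|\mathcal X|-1\}$ and similarly for $\mathcal Y,\mathcal Z$. Consider processes $(X_i,Y_i,Z_i)_{i\in\mathbb Z}$ with values in $\mathcal X\times\mathcal Y\times\mathcal Z$ that are jointly stationary, irreducible, aperiodic and jointly $d$-Markov without instantaneous influences, that is, $$p(x_i,y_i,z_i\mid \text{past})=\prod_{s\in\{x_i,y_i,z_i\}}p(s\mid x_{i-d}^{i-1},y_{i-d}^{i-1},z_{i-d}^{i-1}).$$ Irreducible means that for any two joint values $v,v'$ there is $\tau\ge1$ with $P((X,Y,Z)_0=v,\ (X,Y,Z)_\tau=v')>0$; aperiodic means that for every $v$ the set of $\tau\ge 1$ with $P((X,Y,Z)_0=v,\ (X,Y,Z)_\tau=v)>0$ has greatest common divisor $1$. (For $d\geq 1$ both hold if the chain of $d$-blocks is irreducible and aperiodic.) The parameters $\theta\in\mathbb R^N$ of such a process are its transition probabilities $p(s\mid b)$, where $b$ runs over the histories in $(\mathcal X\times\mathcal Y\times\mathcal Z)^d$ and, for each of the three processes, $s$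 runs over the nonzero letters of its alphabet. The probability of the letter $0$ is one minus the sum of the others, so $N=(|\mathcal X|+|\mathcal Y|+|\mathcal Z|-3)\,(|\mathcal X||\mathcal Y||\mathcal Z|)^d$. The Bayesian network of the process has the nodes $X_i,Y_i,Z_i$ $(i\in\mathbb Z)$ and an edge $S_{i-k}\to S'_i$, for $S,S'\in\{X,Y,Z\}$ and $1\le k\le d$, exactly when $$I\bigl(S_{i-k};S'_i\mid \{X_{i-d}^{i-1},Y_{i-d}^{i-1},Z_{i-d}^{i-1}\}\setminus \{S_{i-k}\}\bigr)>0 .$$ For disjoint sets of nodes, $C$ d-separates $A$ and $B$ if, after restricting the network to the nodes that are in $A\cup B\cup C$ or have a directed path to it, joining any two nodes with a common child, removing the nodes of $C$ and forgetting directions, no path connects $A$ and $B$. The process $X$ is conditionally $l$-Markov given $Z$ if $p(x_i\mid x_{i-n}^{i-1},z_{i-n}^{i-1})=p(x_i\mid x_{i-l}^{i-1},z_{i-l}^{i-1})$ for all $i$, all $n\ge l$ and all pasts of positive probability. Then the set of parameters $\theta\in\mathbb R^N$ that define such a process for which there is a positive integer $l$ such that $X$ is conditionally $l$-Markov given $Z$,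 but for some $i$ the window $(X_{i-l}^{i-1},Z_{i-l}^{i-1})$ does not d-separate $X_i$ from the earlier past $\{X_j,Z_j: j\le i-l-1\}$ in the Bayesian network, has Lebesgue measure zero in $\mathbb R^N$. -/

import Mathlib

namespace MarkovNet

open MeasureTheory

/-- The three component processes. -/
inductive Proc : Type
  | X
  | Y
  | Z
  deriving DecidableEq

instance : Fintype Proc := ⟨{Proc.X, Proc.Y, Proc.Z}, fun S => by cases S <;> simp⟩

/-- A node of the time-indexed network: `(S, i)` is the variable `S_i`. -/
abbrev Node : Type := Proc × ℤ

/-- The alphabet of the process `S` is `{0, 1, …, m S}`, of size `m S + 1`. -/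
abbrev Alph (m : Proc → ℕ) (S : Proc) : Type := Fin (m S + 1)

/-- Joint values `(x, y, z)` of the three processes at one time. -/
abbrev State (m : Proc → ℕ) : Type := (S : Proc) → Alph m S

/-- A history of length `d`; the entry `k` is the joint value at lag `k + 1`. -/
abbrev Hist (d : ℕ) (m : Proc → ℕ) : Type := Fin d → State m

/-- Two-sided sample paths of `(X, Y, Z)`. -/
abbrev Path (m : Proc → ℕ) : Type := (v : Node) → Alph m v.1

/-- Indices of the free parameters: a history `b`, a process `S`, and a nonzero letter `j + 1` of
its alphabet. The probability of the letter `0` is determined by the others, so it is not a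
parameter. The number of parameters is `N = (m X + m Y + m Z) * |State| ^ d`. -/
abbrev ParamIdx (d : ℕ) (m : Proc → ℕ) : Type := Hist d m × (Σ S : Proc, Fin (m S))

/-- The parameter space `ℝ ^ N`. -/
abbrev Param (d : ℕ) (m : Proc → ℕ) : Type := ParamIdx d m → ℝ

variable {d : ℕ} {m : Proc → ℕ}

/-- `p(S_i = x | history = b)` as a function of the parameters. -/
def condPmf (θ : Param d m) (S : Proc) (b : Hist d m) (x : Alph m S) : ℝ :=
  Fin.cases (1 - ∑ j : Fin (m S), θ (b, ⟨S, j⟩)) (fun j => θ (b, ⟨S, j⟩)) x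

/-- The parameters describe probability distributions. -/
def IsStochastic (θ : Param d m) : Prop :=
  ∀ (S : Proc) (b : Hist d m) (x : Alph m S), 0 ≤ condPmf θ S b x

/-- The event that the path agrees with `a` on the nodes of `F`. -/
def cyl (F : Finset Node) (a : Path m) : Set (Path m) := {ω | ∀ v ∈ F, ω v = a v}

/-- The joint value at time `i`. -/
def stateAt (ω : Path m) (i : ℤ) : State m := fun S => ω (S, i)

/-- The joint values at times `i - 1, …, i - d`. -/
def histAt (d : ℕ) (ω : Path m) (i : ℤ) : Hist d m := fun k => stateAt ω (i - 1 - (k : ℕ))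

/-- The nodes of all three processes at times `i - n, …, i - 1`. -/
noncomputable def jointWindow (n : ℕ) (i : ℤ) : Finset Node := Finset.univ ×ˢ Finset.Ico (i - n) i

/-- The nodes of `X` and `Z` at times `i - n, …, i - 1`. -/
noncomputable def xzWindow (n : ℕ) (i : ℤ) : Finset Node := {Proc.X, Proc.Z} ×ˢ Finset.Ico (i - n) i

/-- The time shift on paths. -/
def shift (ω : Path m) : Path m := fun v => ω (v.1, v.2 + 1)

/-- Joint stationarity. -/
def IsStationary (P : Measure (Path m)) : Prop := MeasurePreserving shift P P

/-- `(X, Y, Z)` is jointly `d`-Markov without instantaneous influences, with the conditional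
probabilities given by `θ`: for every past of length `n ≥ d` that has positive probability,
`p(x_i, y_i, z_i | past) = ∏_S p_θ(s_i | last d joint values)`. -/
def HasTransitions (P : Measure (Path m)) (θ : Param d m) : Prop :=
  ∀ (i : ℤ) (n : ℕ), d ≤ n → ∀ a : Path m, P (cyl (jointWindow n i) a) ≠ 0 →
    ProbabilityTheory.cond P (cyl (jointWindow n i) a) {ω | stateAt ω i = stateAt a i} =
      ENNReal.ofReal (∏ S : Proc, condPmf θ S (histAt d a i) (a (S, i)))

/-- Every joint value can be visited from every joint value. -/
def IsIrreducible (P : Measure (Path m)) : Prop :=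
  ∀ s s' : State m, ∃ τ : ℕ, 0 < τ ∧ P {ω | stateAt ω 0 = s ∧ stateAt ω τ = s'} ≠ 0

/-- For every joint value, the possible return times have greatest common divisor one. -/
def IsAperiodic (P : Measure (Path m)) : Prop :=
  ∀ (s : State m) (g : ℕ),
    (∀ τ : ℕ, 0 < τ → P {ω | stateAt ω 0 = s ∧ stateAt ω τ = s} ≠ 0 → g ∣ τ) → g = 1

/-- `P` is the law of a stationary, irreducible, aperiodic, jointly `d`-Markov process `(X, Y, Z)`
without instantaneous influences whose parameters are `θ`. -/
structure IsLawOf (θ : Param d m) (P : Measure (Path m)) : Prop where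
  stochastic : IsStochastic θ
  probability : IsProbabilityMeasure P
  stationary : IsStationary P
  transitions : HasTransitions P θ
  irreducible : IsIrreducible P
  aperiodic : IsAperiodic P

/-- `X` is conditionally `l`-Markov given `Z`: for every past of `(X, Z)` of length `n ≥ l` that
has positive probability, `p(x_i | x_{i-n}^{i-1}, z_{i-n}^{i-1}) = p(x_i | x_{i-l}^{i-1},
z_{i-l}^{i-1})`. -/
def IsCondMarkov (P : Measure (Path m)) (l : ℕ) : Prop :=
  ∀ (i : ℤ) (n : ℕ), l ≤ n → ∀ a : Path m, P (cyl (xzWindow n i) a) ≠ 0 →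
    ProbabilityTheory.cond P (cyl (xzWindow n i) a) {ω | ω (Proc.X, i) = a (Proc.X, i)} =
      ProbabilityTheory.cond P (cyl (xzWindow l i) a) {ω | ω (Proc.X, i) = a (Proc.X, i)}

/-- The Shannon entropy of the variables at the nodes of `F`. -/
noncomputable def entropy (P : Measure (Path m)) (F : Finset Node) : ℝ :=
  ∑ w : ((v : F) → Alph m v.1.1), Real.negMulLog (P.real {ω | F.restrict ω = w})

/-- The conditional mutual information `I(F; G | H) = H(F | H) - H(F | G, H)`. -/
noncomputable def condMutualInfo (P : Measure (Path m)) (F G H : Finset Node) : ℝ :=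
  (entropy P (F ∪ H) - entropy P H) - (entropy P (F ∪ (G ∪ H)) - entropy P (G ∪ H))

/-- The edges of the Bayesian network of the process: `S_{i-k} → S'_i`, with `1 ≤ k ≤ d`, is an
edge when `I(S_{i-k}; S'_i | {X, Y, Z}_{i-d}^{i-1} \ S_{i-k}) > 0`. -/
def Edge (d : ℕ) (P : Measure (Path m)) (u v : Node) : Prop :=
  ∃ k : ℕ, 1 ≤ k ∧ k ≤ d ∧ u.2 = v.2 - k ∧
    0 < condMutualInfo P {u} {v} ((jointWindow d v.2).erase u)

section DSep

variable {V : Type*}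

/-- The nodes in `W` or with a directed path to `W`. -/
def ancestral (E : V → V → Prop) (W : Set V) : Set V :=
  {u | ∃ w ∈ W, Relation.ReflTransGen E u w}

/-- The undirected graph of the d-separation algorithm: on the ancestral subgraph of `A ∪ B ∪ C`,
join the nodes that have a common child, forget the directions, and remove the nodes of `C`. -/
def moralGraph (E : V → V → Prop) (A B C : Set V) : SimpleGraph V :=
  SimpleGraph.fromRel fun u v =>
    u ∈ ancestral E (A ∪ B ∪ C) \ C ∧ v ∈ ancestral E (A ∪ B ∪ C) \ C ∧
      (E u v ∨ ∃ w ∈ ancestral E (A ∪ B ∪ C), E u w ∧ E v w)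

/-- `C` d-separates `A` and `B` in the directed acyclic graph with edge relation `E`. -/
def DSeparates (E : V → V → Prop) (C A B : Set V) : Prop :=
  ∀ u ∈ A, ∀ v ∈ B, ¬ (moralGraph E A B C).Reachable u v

end DSep

/-- The nodes of `X` and `Z` at all times up to `i - l - 1`. -/
def xzPast (l : ℕ) (i : ℤ) : Set Node :=
  {v | (v.1 = Proc.X ∨ v.1 = Proc.Z) ∧ v.2 ≤ i - l - 1}

/-- `(X_{i-l}^{i-1}, Z_{i-l}^{i-1})` d-separates `X_i` from `(X^{i-l-1}, Z^{i-l-1})` in the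
Bayesian network of the process. -/
def WindowDSeparates (d : ℕ) (P : Measure (Path m)) (l : ℕ) (i : ℤ) : Prop :=
  DSeparates (Edge d P) (xzWindow l i : Set Node) {(Proc.X, i)} (xzPast l i)

end MarkovNet

open MeasureTheory Set Filter

/-! For each `l`, the conditional `l`-Markov property forces a real analytic (in fact polynomial)
function of `θ` to vanish, and this function is not identically zero whenever d-separation can fail.
Its zero set is then null, and there are countably many `l`.

The equation compares two predictions of `X_0 = 0`, given zeros of `X` and `Z` in windows of lengths
`d + j` and `l`. Cramer's rule gives `det · π` polynomially in `θ` for the stationary law `π`, so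
cross-multiplying and clearing denominators yields `gap θ j l = 0` (`IsLawOf.gap_eq_zero`). On the
graph side, the window contains every parent of `X_i`, hence d-separates, unless `d > 0`, `X` has
two letters, and `Y` has two letters or `l < d` (`of_not_windowDSeparates`).

In those cases a parameter with `gap ≠ 0` is needed. Take transitions that look only at lag `d`, so
the lags split into `d` independent chains by residue. In each chain `Y` is frozen and sets the
probability that `X` keeps its letter. A run of zeros then has as weight a mixture over `y` of
powers of `repeatProb m y`, and such a mixture is not geometric: every further zero is new evidence
about `Y`, so the prediction changes. The frozen chain is perturbed to one with positive
transitions, where `det ≠ 0` by the maximum principle. -/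

/-! ### Null zero sets of real analytic functions. -/

theorem AnalyticOnNhd.volume_zeros_eq_zero {g : ℝ → ℝ} (hg : AnalyticOnNhd ℝ g univ) {t₀ : ℝ}
    (h0 : g t₀ ≠ 0) : volume {t | g t = 0} = 0 := by
  have h1 : {t | g t = 0}ᶜ ∈ codiscrete ℝ := by
    have := hg.preimage_zero_mem_codiscrete h0
    simpa [preimage, compl_def] using this
  have h2 := ae_restrict_le_codiscreteWithin (μ := volume) (U := (univ : Set ℝ))
    MeasurableSet.univ h1
  simpa [mem_ae_iff] using h2

/-- The zero set of a nonzero real analytic function is a null set. -/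
theorem AnalyticOnNhd.addHaar_zeros_eq_zero {E : Type*} [NormedAddCommGroup E] [NormedSpace ℝ E]
    [FiniteDimensional ℝ E] [MeasurableSpace E] [BorelSpace E] (μ : Measure E)
    [μ.IsAddHaarMeasure] {f : E → ℝ} (hf : AnalyticOnNhd ℝ f univ) {x₀ : E} (h0 : f x₀ ≠ 0) :
    μ {x | f x = 0} = 0 := by
  have hfc : Continuous f := by
    rw [← continuousOn_univ]; exact hf.continuousOn
  have hmeas : MeasurableSet {q : E × ℝ | f (x₀ + q.2 • q.1) = 0} :=
    (isClosed_eq (hfc.comp (by fun_prop)) continuous_const).measurableSet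
  -- On each line through `x₀` the restriction of `f` is analytic and nonzero at `t = 0`. By Fubini,
  -- almost every dilate about `x₀` of the zero set is null, and one `t ≠ 0` suffices.
  have hprod : (μ.prod volume) {q : E × ℝ | f (x₀ + q.2 • q.1) = 0} = 0 := by
    rw [Measure.measure_prod_null hmeas]
    refine Eventually.of_forall fun v => ?_
    have hg : AnalyticOnNhd ℝ (fun t : ℝ => f (x₀ + t • v)) univ := by
      intro t _
      exact (hf (x₀ + t • v) (mem_univ _)).fun_comp (f := fun t : ℝ => x₀ + t • v) (by fun_prop)
    exact hg.volume_zeros_eq_zero (t₀ := 0) (by simpa using h0)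
  have hswap : (volume.prod μ) {q : ℝ × E | f (x₀ + q.1 • q.2) = 0} = 0 := by
    have hmeas' : MeasurableSet {q : ℝ × E | f (x₀ + q.1 • q.2) = 0} :=
      (isClosed_eq (hfc.comp (by fun_prop)) continuous_const).measurableSet
    rw [← Measure.prod_swap, Measure.map_apply measurable_swap hmeas']
    exact hprod
  have hae := Measure.measure_ae_null_of_prod_null hswap
  have hne : ∀ᵐ t : ℝ ∂volume, t ≠ 0 := by simp [ae_iff]
  obtain ⟨t, ht, ht0⟩ := (hae.and hne).exists
  replace ht : μ ((fun v : E => t • v) ⁻¹' ((fun v => x₀ + v) ⁻¹' {x | f x = 0})) = 0 := ht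
  rw [Measure.addHaar_preimage_smul μ ht0, measure_preimage_add] at ht
  simpa [ht0] using ht

namespace MarkovNet

variable {d : ℕ} {m : Proc → ℕ}

/-! ### Edges of the network and d-separation by the window. -/

theorem Edge.lt {P : Measure (Path m)} {u v : Node} (h : Edge d P u v) : u.2 < v.2 := by
  obtain ⟨k, hk, -, huv, -⟩ := h
  lia

theorem Edge.reflTransGen_le {P : Measure (Path m)} {u v : Node}
    (h : Relation.ReflTransGen (Edge d P) u v) : u.2 ≤ v.2 := by
  induction h with
  | refl => exact le_rfl
  | tail _ hbc ih => exact ih.trans hbc.lt.le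

/-- The entropy does not change when nodes with one-letter alphabets are added. -/
theorem entropy_eq_of_subset (P : Measure (Path m)) {F G : Finset Node} (hFG : F ⊆ G)
    (h : ∀ v ∈ G, v ∉ F → m v.1 = 0) : entropy P G = entropy P F := by
  classical
  have huniq : ∀ v ∈ G, v ∉ F → ∀ x y : Alph m v.1, x = y := by
    intro v hv hvF x y
    have := h v hv hvF
    ext
    have := x.2
    have := y.2
    lia
  have hinj : Function.Injective (Finset.restrict₂ (π := fun v : Node => Alph m v.1) hFG) := by
    intro w w' hw
    funext ⟨v, hv⟩
    by_cases hvF : v ∈ F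
    · exact congrFun hw ⟨v, hvF⟩
    · exact huniq v hv hvF _ _
  have hsurj : Function.Surjective (Finset.restrict₂ (π := fun v : Node => Alph m v.1) hFG) := by
    intro w
    refine ⟨fun v => if hv : v.1 ∈ F then w ⟨v.1, hv⟩ else 0, ?_⟩
    funext ⟨v, hv⟩
    simp [Finset.restrict₂, hv]
  refine Fintype.sum_bijective _ ⟨hinj, hsurj⟩ _ _ fun w => ?_
  congr 2
  ext ω
  constructor
  · rintro rfl
    rfl
  · intro hω
    exact hinj hω

/-- A one-letter variable carries no entropy, so its conditional mutual information with anything is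
zero. -/
theorem Edge.source_ne_zero {P : Measure (Path m)} {u v : Node} (h : Edge d P u v) :
    m u.1 ≠ 0 := by
  intro hu
  obtain ⟨k, -, -, -, hI⟩ := h
  have key : ∀ F : Finset Node, entropy P ({u} ∪ F) = entropy P F := fun F =>
    entropy_eq_of_subset P Finset.subset_union_right (by
      intro w hw hwF
      simp only [Finset.mem_union, Finset.mem_singleton] at hw
      obtain rfl | hw := hw
      · exact hu
      · exact absurd hw hwF)
  simp only [condMutualInfo, key, sub_self, lt_irrefl] at hI

theorem Edge.target_ne_zero {P : Measure (Path m)} {u v : Node} (h : Edge d P u v) :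
    m v.1 ≠ 0 := by
  intro hv
  obtain ⟨k, -, -, -, hI⟩ := h
  have key : ∀ F : Finset Node, entropy P ({v} ∪ F) = entropy P F := fun F =>
    entropy_eq_of_subset P Finset.subset_union_right (by
      intro w hw hwF
      simp only [Finset.mem_union, Finset.mem_singleton] at hw
      obtain rfl | hw := hw
      · exact hv
      · exact absurd hw hwF)
  simp only [condMutualInfo, Finset.union_left_comm {u} {v}, key, sub_self, lt_irrefl] at hI

/-- If the window contains all parents of `X_i`, then it d-separates `X_i` from the past. -/
theorem windowDSeparates_of_parents_subset {P : Measure (Path m)} {l : ℕ} {i : ℤ}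
    (h : ∀ u, Edge d P u (Proc.X, i) → u ∈ xzWindow l i) : WindowDSeparates d P l i := by
  have hle : ∀ w ∈ ancestral (Edge d P)
      ({(Proc.X, i)} ∪ xzPast l i ∪ (xzWindow l i : Set Node)), w.2 ≤ i := by
    rintro w ⟨w', hw', hww'⟩
    refine (Edge.reflTransGen_le hww').trans ?_
    rcases hw' with (rfl | hw') | hw'
    · exact le_rfl
    · have := hw'.2
      lia
    · simp only [xzWindow, Finset.coe_product, Set.mem_prod, Finset.mem_coe, Finset.mem_Ico] at hw'
      exact hw'.2.2.le
  -- `X_i` is isolated: all ancestral nodes have time at most `i`, so it has no children among them,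
  -- and its parents lie in the window, which is removed.
  have hiso : ∀ u, ¬ (moralGraph (Edge d P) {(Proc.X, i)} (xzPast l i)
      (xzWindow l i : Set Node)).Adj (Proc.X, i) u := by
    intro u hu
    simp only [moralGraph, SimpleGraph.fromRel_adj] at hu
    obtain ⟨-, ⟨-, hu, hE⟩ | ⟨hu, -, hE⟩⟩ := hu
    · rcases hE with hE | ⟨w, hw, hE, -⟩
      · exact absurd hE.lt (not_lt.2 (hle _ hu.1))
      · exact absurd hE.lt (not_lt.2 (hle _ hw))
    · rcases hE with hE | ⟨w, hw, -, hE⟩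
      · exact hu.2 (h _ hE)
      · exact absurd hE.lt (not_lt.2 (hle _ hw))
  rintro u hu v hv hr
  obtain rfl : u = (Proc.X, i) := hu
  obtain ⟨p⟩ := hr
  cases p with
  | nil =>
    have := hv.2
    simp only at this
    lia
  | cons hadj _ => exact hiso _ hadj

/-- Edges join only processes with at least two letters and have lags `1, …, d`. If the conclusion
fails, either `X_i` has no parents or all of them are `X` or `Z` nodes inside the window. -/
theorem of_not_windowDSeparates {P : Measure (Path m)} {l : ℕ} {i : ℤ}
    (h : ¬ WindowDSeparates d P l i) : 0 < d ∧ 0 < m Proc.X ∧ (0 < m Proc.Y ∨ l < d) := by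
  by_contra hc
  refine h (windowDSeparates_of_parents_subset fun u hu => ?_)
  have h1 := hu.source_ne_zero
  have h2 := hu.target_ne_zero
  obtain ⟨k, hk, hkd, huk, -⟩ := hu
  simp only at h2 huk
  have h3 : m Proc.Y = 0 ∧ d ≤ l := by
    by_contra hd
    exact hc ⟨by lia, by lia, by lia⟩
  have h4 : u.1 = Proc.X ∨ u.1 = Proc.Z := by
    rcases hS : u.1 with _ | _ | _
    · simp
    · rw [hS] at h1; exact absurd h3.1 h1
    · simp
  simp only [xzWindow, Finset.mem_product, Finset.mem_insert, Finset.mem_singleton, Finset.mem_Ico]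
  exact ⟨h4, by lia, by lia⟩

/-! ### The stationary law by Cramer's rule. -/

/-- The probability of the joint value `s` after the history `b`. -/
noncomputable def stateProb (θ : Param d m) (b : Hist d m) (s : State m) : ℝ :=
  ∏ S : Proc, condPmf θ S b (s S)

/-- The `d` most recent entries of a history of length `n ≥ d`. -/
def recent {n : ℕ} (h : d ≤ n) (w : Hist n m) : Hist d m := fun k => w (k.castLE h)

/-- The history after the joint value `s` has been observed. -/
def pushHist (s : State m) (b : Hist d m) : Hist d m :=
  recent (Nat.le_succ d) (Fin.cons s b : Hist (d + 1) m)

/-- The transition matrix of the chain of `d`-blocks. -/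
noncomputable def transMatrix (θ : Param d m) : Matrix (Hist d m) (Hist d m) ℝ :=
  fun b b' => ∑ s, if pushHist s b = b' then stateProb θ b s else 0

/-- The matrix `1 - K + J`, where `K` is the transition matrix and all entries of `J` are `1`. -/
noncomputable def balanceMatrix (θ : Param d m) : Matrix (Hist d m) (Hist d m) ℝ :=
  1 - transMatrix θ + Matrix.of fun _ _ => 1

/-- The determinant of the balance matrix times the stationary distribution. -/
noncomputable def statNum (θ : Param d m) : Hist d m → ℝ :=
  Matrix.vecMul 1 (balanceMatrix θ).adjugate

theorem sum_condPmf (θ : Param d m) (S : Proc) (b : Hist d m) : ∑ x, condPmf θ S b x = 1 := by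
  rw [Fin.sum_univ_succ]
  simp [condPmf]

/-- A marginal of a product of probability vectors. -/
theorem sum_prod_ite_eq (f : (S : Proc) → Alph m S → ℝ) (hf : ∀ S, ∑ x, f S x = 1) (S₀ : Proc)
    (x₀ : Alph m S₀) : (∑ s : State m, if s S₀ = x₀ then ∏ S, f S (s S) else 0) = f S₀ x₀ := by
  classical
  have h1 : ∀ s : State m, (if s S₀ = x₀ then ∏ S, f S (s S) else 0)
      = ∏ S, (if h : S = S₀ then if s S = h ▸ x₀ then f S (s S) else 0 else f S (s S)) := by
    intro s
    split_ifs with h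
    · refine Finset.prod_congr rfl fun S _ => ?_
      split_ifs with h1 h2
      · rfl
      · subst h1; exact absurd h h2
      · rfl
    · symm
      exact Finset.prod_eq_zero (Finset.mem_univ S₀) (by simp [h])
  have h2 := Fintype.prod_sum (fun (S : Proc) (x : Alph m S) =>
    if h : S = S₀ then if x = h ▸ x₀ then f S x else 0 else f S x)
  simp only [h1]
  rw [← h2, Finset.prod_eq_single S₀]
  · simp
  · intro S _ hS
    simp [hS, hf]
  · simp

theorem sum_prod_eq_one (f : (S : Proc) → Alph m S → ℝ) (hf : ∀ S, ∑ x, f S x = 1) :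
    ∑ s : State m, ∏ S, f S (s S) = 1 := by
  rw [← Fintype.prod_sum]
  simp [hf]

theorem sum_stateProb (θ : Param d m) (b : Hist d m) : ∑ s, stateProb θ b s = 1 :=
  sum_prod_eq_one _ fun S => sum_condPmf θ S b

theorem sum_stateProb_ite (θ : Param d m) (b : Hist d m) (S : Proc) (x : Alph m S) :
    (∑ s : State m, if s S = x then stateProb θ b s else 0) = condPmf θ S b x :=
  sum_prod_ite_eq (fun S => condPmf θ S b) (fun S => sum_condPmf θ S b) S x

/-- From `πK = π` and total mass one, `π(1 - K + J)` is the all-ones row; multiply by the adjugate.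
No inverse occurs, so this also holds where the determinant is zero. -/
theorem det_mul_eq_statNum (θ : Param d m) (π : Hist d m → ℝ) (h1 : ∑ b, π b = 1)
    (hπ : Matrix.vecMul π (transMatrix θ) = π) (b : Hist d m) :
    (balanceMatrix θ).det * π b = statNum θ b := by
  have h2 : Matrix.vecMul π (balanceMatrix θ) = 1 := by
    rw [balanceMatrix, Matrix.vecMul_add, Matrix.vecMul_sub, hπ, Matrix.vecMul_one, sub_self,
      zero_add]
    ext b
    simp [Matrix.vecMul, dotProduct, h1]
  rw [statNum, ← h2, Matrix.vecMul_vecMul, Matrix.mul_adjugate, Matrix.vecMul_smul,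
    Matrix.vecMul_one]
  rfl

/-! ### Probabilities of words under the law of the process. -/

theorem histAt_succ (n : ℕ) (ω : Path m) (i : ℤ) :
    histAt (n + 1) ω (i + 1) = Fin.cons (stateAt ω i) (histAt n ω i) := by
  funext k
  refine Fin.cases ?_ (fun k => ?_) k
  · simp [histAt]
  · simp only [histAt, Fin.cons_succ, Fin.val_succ]
    congr 1
    push_cast
    ring

theorem histAt_surjective (n : ℕ) (i : ℤ) (w : Hist n m) : ∃ a : Path m, histAt n a i = w := by
  refine ⟨fun v => if h : (i - 1 - v.2).toNat < n then w ⟨_, h⟩ v.1 else 0, ?_⟩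
  funext k S
  have : (i - 1 - (i - 1 - ((k : ℕ) : ℤ))).toNat = k := by lia
  simp [histAt, stateAt]

theorem mem_cyl_jointWindow {n : ℕ} {i : ℤ} {a ω : Path m} :
    ω ∈ cyl (jointWindow n i) a ↔ histAt n ω i = histAt n a i := by
  simp only [cyl, jointWindow, Finset.mem_product, Finset.mem_univ, true_and, Finset.mem_Ico,
    Set.mem_ofPred_eq]
  constructor
  · intro h
    funext k S
    exact h (S, i - 1 - (k : ℕ)) ⟨by have := k.2; simp only; lia, by simp only; lia⟩
  · rintro h ⟨S, t⟩ ⟨h1, h2⟩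
    simp only at h1 h2
    have h3 := congrFun (congrFun h ⟨(i - 1 - t).toNat, by lia⟩) S
    have h4 : i - 1 - (((i - 1 - t).toNat : ℕ) : ℤ) = t := by lia
    have key : ∀ t', t' = t → ω (S, t') = a (S, t') → ω (S, t) = a (S, t) := by
      rintro _ rfl h
      exact h
    exact key _ h4 h3

theorem measurable_stateAt (i : ℤ) : Measurable fun ω : Path m => stateAt ω i :=
  measurable_pi_lambda _ fun S => measurable_pi_apply (S, i)

theorem measurable_histAt (n : ℕ) (i : ℤ) : Measurable fun ω : Path m => histAt n ω i :=
  measurable_pi_lambda _ fun _ => measurable_stateAt _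

theorem real_histAt_eq_sum (P : Measure (Path m)) [IsFiniteMeasure P] (n : ℕ) (i : ℤ)
    (G : Hist n m → Prop) [DecidablePred G] :
    P.real {ω | G (histAt n ω i)} = ∑ w, if G w then P.real {ω | histAt n ω i = w} else 0 := by
  rw [← Finset.sum_filter]
  have := sum_measureReal_preimage_singleton (μ := P) (Finset.univ.filter G)
    (f := fun ω : Path m => histAt n ω i)
    (fun y _ => measurable_histAt n i (measurableSet_singleton y))
  rw [show {ω : Path m | G (histAt n ω i)} = (fun ω : Path m => histAt n ω i) ⁻¹'
    (Finset.univ.filter G : Finset (Hist n m)) by ext; simp, ← this]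
  rfl

theorem sum_hist_succ {n : ℕ} (f : Hist (n + 1) m → ℝ) :
    ∑ w, f w = ∑ w : Hist n m, ∑ s : State m, f (Fin.cons s w) := by
  rw [← (Fin.consEquiv fun _ : Fin (n + 1) => State m).sum_comp, Fintype.sum_prod_type,
    Finset.sum_comm]
  rfl

namespace IsLawOf

variable {θ : Param d m} {P : Measure (Path m)}

theorem real_histAt_succ (hP : IsLawOf θ P) {n : ℕ} (h : d ≤ n) (i : ℤ) (s : State m)
    (w : Hist n m) : P.real {ω | histAt (n + 1) ω (i + 1) = Fin.cons s w} =
      P.real {ω | histAt n ω i = w} * stateProb θ (recent h w) s := by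
  have := hP.probability
  obtain ⟨a, ha⟩ := histAt_surjective (n + 1) (i + 1) (Fin.cons s w : Hist (n + 1) m)
  rw [histAt_succ, Fin.cons_inj] at ha
  obtain ⟨rfl, rfl⟩ := ha
  have hcyl : cyl (jointWindow n i) a = {ω | histAt n ω i = histAt n a i} := by
    ext ω; exact mem_cyl_jointWindow
  have hset : {ω : Path m | histAt (n + 1) ω (i + 1) = Fin.cons (stateAt a i) (histAt n a i)} =
      {ω | histAt n ω i = histAt n a i} ∩ {ω | stateAt ω i = stateAt a i} := by
    ext ω
    simp only [histAt_succ, Fin.cons_inj, mem_ofPred_eq, mem_inter_iff, and_comm]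
  rw [hset]
  -- The transition hypothesis says nothing about null histories, but there both sides are zero.
  by_cases h0 : P {ω | histAt n ω i = histAt n a i} = 0
  · have h0' : P.real {ω | histAt n ω i = histAt n a i} = 0 := by simp [measureReal_def, h0]
    rw [h0', zero_mul]
    refine le_antisymm ?_ measureReal_nonneg
    rw [← h0']
    exact measureReal_mono inter_subset_left
  · have ht := hP.transitions i n h a (by rwa [hcyl])
    have hm : MeasurableSet {ω : Path m | histAt n ω i = histAt n a i} :=
      measurable_histAt n i (measurableSet_singleton _)
    rw [hcyl] at ht
    rw [measureReal_def, ← ProbabilityTheory.cond_mul_eq_inter hm, ht, ENNReal.toReal_mul,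
      ENNReal.toReal_ofReal, mul_comm]
    · rfl
    · exact Finset.prod_nonneg fun S _ => hP.stochastic _ _ _

theorem real_histAt_add_one (hP : IsLawOf θ P) (n : ℕ) (i : ℤ) (w : Hist n m) :
    P.real {ω | histAt n ω (i + 1) = w} = P.real {ω | histAt n ω i = w} := by
  have hm : MeasurableSet {ω : Path m | histAt n ω i = w} :=
      measurable_histAt n i (measurableSet_singleton _)
  have h := hP.stationary.measureReal_preimage hm.nullMeasurableSet
  rw [← h]
  congr 1
  ext ω
  have : histAt n (shift ω) i = histAt n ω (i + 1) := by
    funext k S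
    simp only [histAt, stateAt, shift]
    congr 2
    ring
  simp [this]

theorem vecMul_transMatrix (hP : IsLawOf θ P) (i : ℤ) :
    Matrix.vecMul (fun b => P.real {ω | histAt d ω i = b}) (transMatrix θ) =
      fun b => P.real {ω | histAt d ω i = b} := by
  classical
  have := hP.probability
  funext b'
  have h1 : {ω : Path m | histAt d ω (i + 1) = b'} =
    {ω | recent (Nat.le_succ d) (histAt (d + 1) ω (i + 1)) = b'} := rfl
  rw [← hP.real_histAt_add_one, h1,
    real_histAt_eq_sum P (d + 1) (i + 1) (fun w => recent (Nat.le_succ d) w = b'),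
    sum_hist_succ]
  simp only [Matrix.vecMul, dotProduct, transMatrix, Finset.mul_sum]
  refine Finset.sum_congr rfl fun b _ => Finset.sum_congr rfl fun s _ => ?_
  rw [hP.real_histAt_succ le_rfl]
  simp only [mul_ite, mul_zero]
  rfl

theorem sum_real_histAt (hP : IsLawOf θ P) (i : ℤ) :
    ∑ b, P.real {ω | histAt d ω i = b} = 1 := by
  have := hP.probability
  simpa using (real_histAt_eq_sum P d i (fun _ => True)).symm

theorem det_mul_real_histAt (hP : IsLawOf θ P) (i : ℤ) (b : Hist d m) :
    (balanceMatrix θ).det * P.real {ω | histAt d ω i = b} = statNum θ b :=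
  det_mul_eq_statNum θ _ (hP.sum_real_histAt i) (hP.vecMul_transMatrix i) b

end IsLawOf

/-! ### The polynomial equation forced by the conditional Markov property. -/

/-- The determinant of the balance matrix times the probability of a word of length `d + j`. -/
noncomputable def pathWeight (θ : Param d m) : (j : ℕ) → Hist (d + j) m → ℝ
  | 0, w => statNum θ w
  | j + 1, w => pathWeight θ j (Fin.tail w) *
      stateProb θ (recent (Nat.le_add_right d j) (Fin.tail w)) (w 0)

/-- The letters of `X` and `Z` at lags `1, …, l` are `0`. -/
def XZZero {n : ℕ} (l : ℕ) (w : Hist n m) : Prop :=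
  ∀ k : Fin n, (k : ℕ) < l → w k Proc.X = 0 ∧ w k Proc.Z = 0

instance {n : ℕ} (l : ℕ) : DecidablePred (XZZero (n := n) (m := m) l) := fun _ =>
  inferInstanceAs (Decidable (∀ _, _))

/-- The determinant of the balance matrix times the probability that the letters of `X` and `Z` at
lags `1, …, l` are `0`. -/
noncomputable def pastWeight (θ : Param d m) (j l : ℕ) : ℝ :=
  ∑ w : Hist (d + j) m, if XZZero l w then pathWeight θ j w else 0

/-- The determinant of the balance matrix times the probability that the letters of `X` and `Z` at
lags `1, …, l` and the present letter of `X` are `0`. -/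
noncomputable def nextWeight (θ : Param d m) (j l : ℕ) : ℝ :=
  ∑ w : Hist (d + j) m, if XZZero l w then
    pathWeight θ j w * condPmf θ Proc.X (recent (Nat.le_add_right d j) w) 0 else 0

/-- This vanishes if the windows of lengths `d + j` and `l`, filled with zeros, give the same
prediction. -/
noncomputable def gap (θ : Param d m) (j l : ℕ) : ℝ :=
  nextWeight θ j (d + j) * pastWeight θ j l - nextWeight θ j l * pastWeight θ j (d + j)

namespace IsLawOf

variable {θ : Param d m} {P : Measure (Path m)}

theorem det_mul_real_histAt_add (hP : IsLawOf θ P) (i : ℤ) (j : ℕ) (w : Hist (d + j) m) :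
    (balanceMatrix θ).det * P.real {ω | histAt (d + j) ω i = w} = pathWeight θ j w := by
  induction j generalizing i with
  | zero => exact hP.det_mul_real_histAt i w
  | succ j ih =>
    obtain ⟨i, rfl⟩ : ∃ i', i = i' + 1 := ⟨i - 1, by ring⟩
    have h := hP.real_histAt_succ (Nat.le_add_right d j) i (w 0) (Fin.tail w)
    rw [Fin.cons_self_tail] at h
    rw [pathWeight, ← ih i (Fin.tail w), mul_assoc, ← h]
    rfl

theorem pastWeight_eq (hP : IsLawOf θ P) (i : ℤ) (j l : ℕ) : pastWeight θ j l =
    (balanceMatrix θ).det * P.real {ω | XZZero l (histAt (d + j) ω i)} := by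
  have := hP.probability
  rw [real_histAt_eq_sum, Finset.mul_sum, pastWeight]
  refine Finset.sum_congr rfl fun w _ => ?_
  rw [mul_ite, mul_zero, hP.det_mul_real_histAt_add]

theorem nextWeight_eq (hP : IsLawOf θ P) (i : ℤ) (j l : ℕ) : nextWeight θ j l =
    (balanceMatrix θ).det *
      P.real ({ω | XZZero l (histAt (d + j) ω i)} ∩ {ω | ω (Proc.X, i) = 0}) := by
  have := hP.probability
  have h1 : {ω : Path m | XZZero l (histAt (d + j) ω i)} ∩ {ω | ω (Proc.X, i) = 0} =
      {ω | (fun w : Hist (d + j + 1) m => XZZero l (Fin.tail w) ∧ w 0 Proc.X = 0)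
        (histAt (d + j + 1) ω (i + 1))} := by
    ext ω
    simp only [histAt_succ, Fin.tail_cons, Fin.cons_zero]
    rfl
  rw [h1, real_histAt_eq_sum P (d + j + 1) (i + 1)
    (fun w : Hist (d + j + 1) m => XZZero l (Fin.tail w) ∧ w 0 Proc.X = 0),
    sum_hist_succ, Finset.mul_sum,
    nextWeight]
  refine Finset.sum_congr rfl fun w _ => ?_
  simp only [Fin.tail_cons, Fin.cons_zero, hP.real_histAt_succ (Nat.le_add_right d j)]
  split_ifs with h
  · simp only [h, true_and, ← hP.det_mul_real_histAt_add i, ← sum_stateProb_ite, Finset.mul_sum,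
      mul_ite, mul_zero, mul_assoc]
  · simp [h]

/-- Equality of the two conditional probabilities of `X_0 = 0`, cross-multiplied and scaled by the
squared determinant. -/
theorem gap_eq_zero (hP : IsLawOf θ P) {j l : ℕ} (hl : l ≤ d + j) (hM : IsCondMarkov P l) :
    gap θ j l = 0 := by
  have := hP.probability
  have hset : ∀ k ≤ d + j, cyl (xzWindow k 0) (fun _ => 0) =
      {ω : Path m | XZZero k (histAt (d + j) ω 0)} := by
    intro k hk
    ext ω
    simp only [cyl, xzWindow, Finset.mem_product, Finset.mem_insert, Finset.mem_singleton,
      Finset.mem_Ico, Set.mem_ofPred_eq, XZZero, histAt, stateAt]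
    constructor
    · intro h t ht
      exact ⟨h (Proc.X, _) ⟨by simp, by simp only; lia, by simp only; lia⟩,
        h (Proc.Z, _) ⟨by simp, by simp only; lia, by simp only; lia⟩⟩
    · rintro h ⟨S, t⟩ ⟨hS, h1, h2⟩
      simp only at h1 h2 hS
      have h3 := h ⟨(0 - 1 - t).toNat, by lia⟩ (by simp only; lia)
      have key : ∀ t', t' = t → ω (S, t') = 0 → ω (S, t) = 0 := by
        rintro _ rfl h
        exact h
      refine key _ (by lia : (0 : ℤ) - 1 - ((0 - 1 - t).toNat : ℕ) = t) ?_
      rcases hS with rfl | rfl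
      · exact h3.1
      · exact h3.2
  have hmeas : ∀ k, MeasurableSet {ω : Path m | XZZero k (histAt (d + j) ω 0)} := fun k =>
    measurable_histAt (d + j) 0 (MeasurableSet.of_discrete (s := {w | XZZero k w}))
  rw [gap, hP.nextWeight_eq 0, hP.pastWeight_eq 0, hP.nextWeight_eq 0, hP.pastWeight_eq 0]
  set A := {ω : Path m | XZZero (d + j) (histAt (d + j) ω 0)} with hA
  set B := {ω : Path m | XZZero l (histAt (d + j) ω 0)} with hB
  set E := {ω : Path m | ω (Proc.X, 0) = 0} with hE
  have hAB : A ⊆ B := fun ω hω k hk => hω k k.2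
  have key : P.real (A ∩ E) * P.real B = P.real (B ∩ E) * P.real A := by
    -- The Markov property applies only to pasts of positive probability. If the longer window is
    -- null, both products are zero.
    by_cases h0 : P A = 0
    · have h1 : P.real A = 0 := by simp [measureReal_def, h0]
      have h2 : P.real (A ∩ E) = 0 :=
        le_antisymm (h1 ▸ measureReal_mono inter_subset_left) measureReal_nonneg
      rw [h1, h2, zero_mul, mul_zero]
    · have hc := hM 0 (d + j) hl (fun _ => 0) (by rwa [hset _ le_rfl])
      rw [hset _ le_rfl, hset _ hl, ← hA, ← hB] at hc
      have e1 := congrArg ENNReal.toReal (ProbabilityTheory.cond_mul_eq_inter (hmeas (d + j)) E P)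
      have e2 := congrArg ENNReal.toReal (ProbabilityTheory.cond_mul_eq_inter (hmeas l) E P)
      rw [ENNReal.toReal_mul] at e1 e2
      simp only [measureReal_def]
      rw [← e1, ← e2]
      have hc' : ProbabilityTheory.cond P A E = ProbabilityTheory.cond P B E := hc
      rw [hc']
      ring
  linear_combination (balanceMatrix θ).det ^ 2 * key

end IsLawOf

/-! ### Analyticity in the parameters. -/

section Analytic

theorem analyticOnNhd_condPmf (S : Proc) (b : Hist d m) (x : Alph m S) :
    AnalyticOnNhd ℝ (fun θ : Param d m => condPmf θ S b x) univ := by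
  have hc : ∀ k : ParamIdx d m, AnalyticOnNhd ℝ (fun θ : Param d m => θ k) univ := fun k =>
    (ContinuousLinearMap.proj (R := ℝ) (φ := fun _ : ParamIdx d m => ℝ) k).analyticOnNhd _
  refine Fin.cases ?_ (fun k => ?_) x
  · exact analyticOnNhd_const.sub (Finset.analyticOnNhd_fun_sum _ fun k _ => hc _)
  · exact hc _

theorem analyticOnNhd_stateProb (b : Hist d m) (s : State m) :
    AnalyticOnNhd ℝ (fun θ : Param d m => stateProb θ b s) univ :=
  Finset.analyticOnNhd_fun_prod _ fun S _ => analyticOnNhd_condPmf S b (s S)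

theorem analyticOnNhd_balanceMatrix (b b' : Hist d m) :
    AnalyticOnNhd ℝ (fun θ : Param d m => balanceMatrix θ b b') univ := by
  refine (analyticOnNhd_const.sub ?_).add analyticOnNhd_const
  refine Finset.analyticOnNhd_fun_sum _ fun s _ => ?_
  split_ifs
  · exact analyticOnNhd_stateProb b s
  · exact analyticOnNhd_const

theorem analyticOnNhd_det {E n : Type*} [NormedAddCommGroup E] [NormedSpace ℝ E] [Fintype n]
    [DecidableEq n] {A : E → Matrix n n ℝ} (hA : ∀ a b, AnalyticOnNhd ℝ (fun x => A x a b) univ) :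
    AnalyticOnNhd ℝ (fun x => (A x).det) univ := by
  simp only [Matrix.det_apply']
  exact Finset.analyticOnNhd_fun_sum _ fun σ _ =>
    analyticOnNhd_const.mul (Finset.analyticOnNhd_fun_prod _ fun a _ => hA _ _)

theorem analyticOnNhd_statNum (b : Hist d m) :
    AnalyticOnNhd ℝ (fun θ : Param d m => statNum θ b) univ := by
  simp only [statNum, Matrix.vecMul, dotProduct]
  refine Finset.analyticOnNhd_fun_sum _ fun a _ => analyticOnNhd_const.mul ?_
  simp only [Matrix.adjugate_apply]
  refine analyticOnNhd_det fun i k => ?_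
  simp only [Matrix.updateRow_apply]
  split_ifs
  · exact analyticOnNhd_const
  · exact analyticOnNhd_balanceMatrix _ _

theorem analyticOnNhd_pathWeight (j : ℕ) (w : Hist (d + j) m) :
    AnalyticOnNhd ℝ (fun θ : Param d m => pathWeight θ j w) univ := by
  induction j with
  | zero => exact analyticOnNhd_statNum w
  | succ j ih => exact (ih _).mul (analyticOnNhd_stateProb _ _)

theorem analyticOnNhd_pastWeight (j l : ℕ) :
    AnalyticOnNhd ℝ (fun θ : Param d m => pastWeight θ j l) univ := by
  refine Finset.analyticOnNhd_fun_sum _ fun w _ => ?_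
  split_ifs
  · exact analyticOnNhd_pathWeight j w
  · exact analyticOnNhd_const

theorem analyticOnNhd_nextWeight (j l : ℕ) :
    AnalyticOnNhd ℝ (fun θ : Param d m => nextWeight θ j l) univ := by
  refine Finset.analyticOnNhd_fun_sum _ fun w _ => ?_
  split_ifs
  · exact (analyticOnNhd_pathWeight j w).mul (analyticOnNhd_condPmf _ _ _)
  · exact analyticOnNhd_const

theorem analyticOnNhd_gap (j l : ℕ) :
    AnalyticOnNhd ℝ (fun θ : Param d m => gap θ j l) univ :=
  ((analyticOnNhd_nextWeight _ _).mul (analyticOnNhd_pastWeight _ _)).sub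
    ((analyticOnNhd_nextWeight _ _).mul (analyticOnNhd_pastWeight _ _))

end Analytic

/-- Since `gap` is analytic on all of `ℝ ^ N`, one nonzero value per `l` suffices; `j` may depend on
`l`. -/
theorem volume_eq_zero_of_gap_ne_zero (H : ∀ l : ℕ, 0 < d → 0 < m Proc.X →
    (0 < m Proc.Y ∨ l < d) → ∃ j : ℕ, l ≤ d + j ∧ ∃ θ : Param d m, gap θ j l ≠ 0) :
    volume {θ : Param d m | ∃ P : Measure (Path m), IsLawOf θ P ∧
      ∃ l : ℕ, 0 < l ∧ IsCondMarkov P l ∧ ∃ i : ℤ, ¬ WindowDSeparates d P l i} = 0 := by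
  have hsub : {θ : Param d m | ∃ P : Measure (Path m), IsLawOf θ P ∧
      ∃ l : ℕ, 0 < l ∧ IsCondMarkov P l ∧ ∃ i : ℤ, ¬ WindowDSeparates d P l i} ⊆
      ⋃ l : ℕ, {θ : Param d m | (0 < d ∧ 0 < m Proc.X ∧ (0 < m Proc.Y ∨ l < d)) ∧
        ∀ j, l ≤ d + j → gap θ j l = 0} := by
    rintro θ ⟨P, hP, l, -, hM, i, hi⟩
    exact mem_iUnion.2 ⟨l, of_not_windowDSeparates hi, fun j hj => hP.gap_eq_zero hj hM⟩
  refine measure_mono_null hsub (measure_iUnion_null fun l => ?_)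
  by_cases hc : 0 < d ∧ 0 < m Proc.X ∧ (0 < m Proc.Y ∨ l < d)
  · obtain ⟨j, hj, θ, hθ⟩ := H l hc.1 hc.2.1 hc.2.2
    exact measure_mono_null (fun θ' hθ' => hθ'.2 j hj)
      ((analyticOnNhd_gap j l).addHaar_zeros_eq_zero volume hθ)
  · simp [hc]

/-! ### Invertibility of the balance matrix. -/

/-- The maximum principle: the balance matrix of a chain with positive transition probabilities is
invertible. -/
theorem det_balanceMatrix_ne_zero {θ : Param d m} (hθ : ∀ S b x, 0 < condPmf θ S b x) :
    (balanceMatrix θ).det ≠ 0 := by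
  intro hdet
  obtain ⟨h, hne, hh⟩ := Matrix.exists_mulVec_eq_zero_iff.2 hdet
  have hpos : ∀ b s, 0 < stateProb θ b s := fun b s => Finset.prod_pos fun S _ => hθ _ _ _
  have heq : ∀ b, h b + ∑ b', h b' = ∑ s, stateProb θ b s * h (pushHist s b) := by
    intro b
    have h1 := congrFun hh b
    rw [balanceMatrix, Matrix.add_mulVec, Matrix.sub_mulVec, Matrix.one_mulVec] at h1
    have h2 : Matrix.mulVec (transMatrix θ) h b = ∑ s, stateProb θ b s * h (pushHist s b) := by
      simp only [Matrix.mulVec, dotProduct, transMatrix, Finset.sum_mul, ite_mul, zero_mul]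
      rw [Finset.sum_comm]
      simp
    have h3 : Matrix.mulVec (Matrix.of fun _ _ => (1 : ℝ)) h b = ∑ b', h b' := by
      simp [Matrix.mulVec, dotProduct]
    simp only [Pi.add_apply, Pi.sub_apply, Pi.zero_apply, h2, h3] at h1
    linarith
  obtain ⟨M, hM⟩ := Finite.exists_max h
  obtain ⟨L, hL⟩ := Finite.exists_min h
  -- A kernel vector satisfies `h + c = Kh` with `c = ∑ h`. Averaging cannot exceed the maximum or
  -- undercut the minimum, so `c ≤ 0` and `c ≥ 0`.
  have hc0 : ∑ b', h b' = 0 := by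
    apply le_antisymm
    · have h1 : ∑ s, stateProb θ M s * h (pushHist s M) ≤ ∑ s, stateProb θ M s * h M :=
        Finset.sum_le_sum fun s _ => mul_le_mul_of_nonneg_left (hM _) (hpos _ _).le
      rw [← Finset.sum_mul, sum_stateProb, ← heq] at h1
      linarith
    · have h1 : ∑ s, stateProb θ L s * h L ≤ ∑ s, stateProb θ L s * h (pushHist s L) :=
        Finset.sum_le_sum fun s _ => mul_le_mul_of_nonneg_left (hL _) (hpos _ _).le
      rw [← Finset.sum_mul, sum_stateProb, ← heq] at h1
      linarith
  have hstepM : ∀ b, h b = h M → h (pushHist 0 b) = h M := by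
    intro b hb
    by_contra hlt
    have h1 : ∑ s, stateProb θ b s * h (pushHist s b) < ∑ s, stateProb θ b s * h M :=
      Finset.sum_lt_sum (fun s _ => mul_le_mul_of_nonneg_left (hM _) (hpos _ _).le)
        ⟨0, Finset.mem_univ _, mul_lt_mul_of_pos_left (lt_of_le_of_ne (hM _) hlt) (hpos _ _)⟩
    rw [← Finset.sum_mul, sum_stateProb, ← heq, hc0] at h1
    linarith
  have hstepL : ∀ b, h b = h L → h (pushHist 0 b) = h L := by
    intro b hb
    by_contra hlt
    have h1 : ∑ s, stateProb θ b s * h L < ∑ s, stateProb θ b s * h (pushHist s b) :=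
      Finset.sum_lt_sum (fun s _ => mul_le_mul_of_nonneg_left (hL _) (hpos _ _).le)
        ⟨0, Finset.mem_univ _, mul_lt_mul_of_pos_left
          (lt_of_le_of_ne (hL _) (Ne.symm hlt)) (hpos _ _)⟩
    rw [← Finset.sum_mul, sum_stateProb, ← heq, hc0] at h1
    linarith
  have hiter : ∀ (c : ℝ), (∀ b, h b = c → h (pushHist 0 b) = c) → ∀ b, h b = c → ∀ n,
      h ((pushHist 0)^[n] b) = c := by
    intro c hc b hb n
    induction n with
    | zero => exact hb
    | succ n ih => rw [Function.iterate_succ_apply']; exact hc _ ih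
  have hzero : ∀ (b : Hist d m) (n : ℕ) (k : Fin d), (k : ℕ) < n →
      (pushHist 0)^[n] b k = (0 : State m) := by
    intro b n
    induction n with
    | zero => intro k hk; lia
    | succ n ih =>
      rintro ⟨k, hkd⟩ hk
      rw [Function.iterate_succ_apply']
      rcases k with _ | k
      · rfl
      · exact ih ⟨k, by lia⟩ (by simpa using hk)
  -- Pushing `d` zeros leads from both the maximizer and the minimizer to the zero history, and
  -- extremal values persist along the way.
  have hML : h M = h L := by
    rw [← hiter _ hstepM M rfl d, ← hiter _ hstepL L rfl d]
    congr 1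
    funext k
    rw [hzero _ _ _ k.2, hzero _ _ _ k.2]
  have hconst : ∀ b, h b = h L := fun b => le_antisymm (hML ▸ hM b) (hL b)
  have hL0 : h L = 0 := by
    simp only [hconst, Finset.sum_const, Finset.card_univ, nsmul_eq_mul] at hc0
    have : (Fintype.card (Hist d m) : ℝ) ≠ 0 := by
      exact_mod_cast Fintype.card_ne_zero
    exact (mul_eq_zero.1 hc0).resolve_left this
  exact hne (funext fun b => by rw [hconst, hL0]; rfl)

/-! ### Transfer-matrix sums along a chain. -/

section ChainSum

variable {St : Type*} [Fintype St]

/-- The sum over all words `c` of length `q + 1` of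
`h (c 0) * (∏ t, ι t (c t)) * ∏ t, K (c (t + 1)) (c t)`. -/
def chainSum (K : St → St → ℝ) : ℕ → (ℕ → St → ℝ) → (St → ℝ) → ℝ
  | 0, ι, h => ∑ s, h s * ι 0 s
  | q + 1, ι, h => chainSum K q (fun t => ι (t + 1)) fun s' => ∑ s, h s * ι 0 s * K s' s

/-- Position `0` is the most recent letter. Summing it out first turns it into a new weight `h` on
the next older letter. -/
theorem sum_eq_chainSum (K : St → St → ℝ) (q : ℕ) (ι : ℕ → St → ℝ) (h : St → ℝ) :
    ∑ c : Fin (q + 1) → St, h (c 0) * (∏ t : Fin (q + 1), ι t (c t)) *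
      ∏ t : Fin q, K (c t.succ) (c t.castSucc) = chainSum K q ι h := by
  induction q generalizing ι h with
  | zero =>
    rw [← (Equiv.funUnique (Fin 1) St).symm.sum_comp]
    simp [chainSum]
  | succ q ih =>
    rw [chainSum, ← ih, ← (Fin.consEquiv fun _ : Fin (q + 2) => St).sum_comp,
      Fintype.sum_prod_type, Finset.sum_comm]
    refine Finset.sum_congr rfl fun c _ => ?_
    rw [Finset.sum_mul, Finset.sum_mul]
    refine Finset.sum_congr rfl fun s _ => ?_
    have h1 := Fin.prod_univ_succ fun t : Fin (q + 2) => ι t ((Fin.cons s c : Fin (q + 2) → St) t)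
    have h2 := Fin.prod_univ_succ fun t : Fin (q + 1) =>
      K ((Fin.cons s c : Fin (q + 2) → St) t.succ) ((Fin.cons s c : Fin (q + 2) → St) t.castSucc)
    simp only [Fin.consEquiv_apply]
    rw [h1, h2]
    simp only [Fin.cons_zero, Fin.cons_succ, Fin.val_zero, Fin.val_succ,
      Fin.castSucc_zero, ← Fin.succ_castSucc]
    ring

theorem chainSum_congr (K : St → St → ℝ) (q : ℕ) {ι ι' : ℕ → St → ℝ}
    (hι : ∀ t ≤ q, ι t = ι' t) (h : St → ℝ) : chainSum K q ι h = chainSum K q ι' h := by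
  induction q generalizing ι ι' h with
  | zero => simp [chainSum, hι 0 le_rfl]
  | succ q ih =>
    rw [chainSum, chainSum, hι 0 (Nat.zero_le _)]
    exact ih (fun t ht => hι (t + 1) (by lia)) _

theorem chainSum_pos {K : St → St → ℝ} (hK : ∀ s s', 0 < K s s') (q : ℕ) {ι : ℕ → St → ℝ}
    (hι : ∀ t s, 0 ≤ ι t s) (hι' : ∀ t, ∃ s, 0 < ι t s) {h : St → ℝ} (hh : ∀ s, 0 < h s) :
    0 < chainSum K q ι h := by
  induction q generalizing ι h with
  | zero =>
    obtain ⟨s, hs⟩ := hι' 0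
    exact Finset.sum_pos' (fun s _ => mul_nonneg (hh s).le (hι 0 s))
      ⟨s, Finset.mem_univ s, mul_pos (hh s) hs⟩
  | succ q ih =>
    refine ih (fun t => hι (t + 1)) (fun t => hι' (t + 1)) fun s' => ?_
    obtain ⟨s, hs⟩ := hι' 0
    exact Finset.sum_pos' (fun s _ => mul_nonneg (mul_nonneg (hh s).le (hι 0 s)) (hK _ _).le)
      ⟨s, Finset.mem_univ s, mul_pos (mul_pos (hh s) hs) (hK _ _)⟩

theorem continuous_chainSum {K : ℝ → St → St → ℝ} (hK : ∀ s s', Continuous fun x => K x s s')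
    (q : ℕ) (ι : ℕ → St → ℝ) {h : ℝ → St → ℝ} (hh : ∀ s, Continuous fun x => h x s) :
    Continuous fun x => chainSum (K x) q ι (h x) := by
  induction q generalizing ι h with
  | zero => exact continuous_finsetSum _ fun s _ => (hh s).mul continuous_const
  | succ q ih =>
    exact ih _ fun s' => continuous_finsetSum _ fun s _ =>
      ((hh s).mul continuous_const).mul (hK _ _)

/-- Distributivity: when the weight factors over residue classes of lags, the letters of different
classes are summed independently. -/
theorem sum_prod_residue {q D : ℕ} (e : Fin (q + 1) × Fin D ≃ Fin (D + q * D))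
    (g : Fin D → (Fin (q + 1) → St) → ℝ) :
    ∑ w : Fin (D + q * D) → St, ∏ r, g r (fun t => w (e (t, r))) = ∏ r, ∑ c, g r c := by
  classical
  rw [Fintype.prod_sum]
  let E : (Fin (D + q * D) → St) ≃ (Fin D → Fin (q + 1) → St) :=
    { toFun := fun w r t => w (e (t, r))
      invFun := fun x k => x (e.symm k).2 (e.symm k).1
      left_inv := fun w => by simp
      right_inv := fun x => by simp }
  exact Fintype.sum_equiv E _ _ fun w => rfl

end ChainSum

/-! ### Chains that depend on a single lag. -/

section LagKernel

variable {e : ℕ}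

/-- The joint transition probabilities of independent updates. -/
def jointKernel (κ : (S : Proc) → State m → Alph m S → ℝ) (s t : State m) : ℝ :=
  ∏ S, κ S s (t S)

/-- The parameters of a process whose transitions depend on the value at lag `e + 1` only. -/
def paramOfKernel (e : ℕ) (κ : (S : Proc) → State m → Alph m S → ℝ) : Param (e + 1) m :=
  fun k => κ k.2.1 (k.1 (Fin.last e)) k.2.2.succ

variable {κ : (S : Proc) → State m → Alph m S → ℝ}

theorem condPmf_paramOfKernel (hκ : ∀ S s, ∑ x, κ S s x = 1) (S : Proc) (b : Hist (e + 1) m)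
    (x : Alph m S) : condPmf (paramOfKernel e κ) S b x = κ S (b (Fin.last e)) x := by
  refine Fin.cases ?_ (fun k => ?_) x
  · have := hκ S (b (Fin.last e))
    rw [Fin.sum_univ_succ] at this
    simp only [condPmf, paramOfKernel, Fin.cases_zero]
    linarith
  · simp [condPmf, paramOfKernel]

theorem stateProb_paramOfKernel (hκ : ∀ S s, ∑ x, κ S s x = 1) (b : Hist (e + 1) m)
    (s : State m) : stateProb (paramOfKernel e κ) b s = jointKernel κ (b (Fin.last e)) s :=
  Finset.prod_congr rfl fun S _ => condPmf_paramOfKernel hκ S b (s S)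

/-- A doubly stochastic kernel makes the uniform law on blocks stationary. -/
theorem statNum_paramOfKernel (hκ : ∀ S s, ∑ x, κ S s x = 1)
    (hcol : ∀ s', ∑ s, jointKernel κ s s' = 1) (b : Hist (e + 1) m) :
    statNum (paramOfKernel e κ) b =
      (balanceMatrix (paramOfKernel e κ)).det * (Fintype.card (Hist (e + 1) m) : ℝ)⁻¹ := by
  have hcard : (Fintype.card (Hist (e + 1) m) : ℝ) ≠ 0 := by
    exact_mod_cast Fintype.card_ne_zero
  refine (det_mul_eq_statNum _ (fun _ => (Fintype.card (Hist (e + 1) m) : ℝ)⁻¹) ?_ ?_ b).symm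
  · rw [Finset.sum_const, Finset.card_univ, nsmul_eq_mul, mul_inv_cancel₀ hcard]
  · funext b'
    simp only [Matrix.vecMul, dotProduct, ← Finset.mul_sum, transMatrix,
      stateProb_paramOfKernel hκ]
    have h1 := sum_hist_succ (m := m) (n := e + 1) fun w =>
      if recent (Nat.le_succ (e + 1)) w = b' then jointKernel κ (w (Fin.last _)) (w 0) else 0
    have h2 : ∑ b : Hist (e + 1) m, ∑ s : State m,
        (if pushHist s b = b' then jointKernel κ (b (Fin.last e)) s else 0) = 1 := by
      refine h1.symm.trans ?_
      have h3 : ∀ (s : State m) (b : Hist (e + 1) m),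
          recent (Nat.le_succ (e + 1)) (Fin.snoc b s : Hist (e + 2) m) = b := fun s b =>
        Fin.init_snoc (α := fun _ => State m) s b
      have h4 : ∀ (s : State m) (b : Hist (e + 1) m),
          (Fin.snoc b s : Hist (e + 2) m) 0 = b 0 := fun s b => congrFun (h3 s b) 0
      have h5 : ∀ (s : State m) (b : Hist (e + 1) m),
          (if recent (Nat.le_succ (e + 1)) (Fin.snoc b s : Hist (e + 2) m) = b' then
            jointKernel κ ((Fin.snoc b s : Hist (e + 2) m) (Fin.last _))
              ((Fin.snoc b s : Hist (e + 2) m) 0) else 0) =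
          if b = b' then jointKernel κ s (b 0) else 0 := by
        intro s b
        rw [h3, h4, Fin.snoc_last]
      -- Splitting off the oldest letter instead of the newest turns the inner sum into a column sum
      -- of the kernel.
      rw [← (Fin.snocEquiv fun _ : Fin (e + 2) => State m).sum_comp, Fintype.sum_prod_type]
      refine (Finset.sum_congr rfl fun s _ => Finset.sum_congr rfl fun b _ => h5 s b).trans ?_
      simp only [Finset.sum_ite_eq', Finset.mem_univ, if_true, hcol]
    rw [h2, mul_one]

theorem pathWeight_paramOfKernel (hκ : ∀ S s, ∑ x, κ S s x = 1)
    (hcol : ∀ s', ∑ s, jointKernel κ s s' = 1) (j : ℕ) (w : Hist (e + 1 + j) m) :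
    pathWeight (paramOfKernel e κ) j w =
      (balanceMatrix (paramOfKernel e κ)).det * (Fintype.card (Hist (e + 1) m) : ℝ)⁻¹ *
        ∏ k : Fin j, jointKernel κ (w ⟨e + 1 + k, by lia⟩) (w ⟨k, by lia⟩) := by
  induction j with
  | zero => simp [pathWeight, statNum_paramOfKernel hκ hcol]
  | succ j ih =>
    rw [pathWeight, ih, Fin.prod_univ_succ, stateProb_paramOfKernel hκ, mul_assoc, mul_assoc,
      mul_assoc, mul_comm (jointKernel κ _ _)]
    rfl

/-- The indicator of the states whose letters of `X` and `Z` are `0`. -/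
def xzInd (s : State m) : ℝ := if s Proc.X = 0 ∧ s Proc.Z = 0 then 1 else 0

/-- The indicators of the window of length `l` along the lags congruent to `r + 1` modulo `D`. -/
def windowInd (D l r t : ℕ) (s : State m) : ℝ := if t * D + r < l then xzInd s else 1

theorem windowInd_nonneg (D l r t : ℕ) (s : State m) : 0 ≤ windowInd D l r t s := by
  unfold windowInd xzInd
  split_ifs <;> norm_num

theorem windowInd_zero (D l r t : ℕ) : windowInd D l r t (0 : State m) = 1 := by
  simp [windowInd, xzInd]

/-- An enumeration of the lags by their quotient and remainder. -/
def lagEquiv (q D : ℕ) : Fin (q + 1) × Fin D ≃ Fin (D + q * D) :=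
  finProdFinEquiv.trans (finCongr (by ring))

theorem lagEquiv_val (q D : ℕ) (t : Fin (q + 1)) (r : Fin D) :
    (lagEquiv q D (t, r) : ℕ) = t * D + r := by
  simp [lagEquiv, mul_comm, add_comm]

theorem ite_xzZero_eq_prod {q D : ℕ} (l : ℕ) (w : Hist (D + q * D) m) :
    (if XZZero l w then (1 : ℝ) else 0) =
      ∏ r : Fin D, ∏ t : Fin (q + 1), windowInd D l r t (w (lagEquiv q D (t, r))) := by
  have h1 : ∀ k : Fin (D + q * D), (if (k : ℕ) < l then xzInd (w k) else 1) =
      if ((k : ℕ) < l → w k Proc.X = 0 ∧ w k Proc.Z = 0) then (1 : ℝ) else 0 := by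
    intro k
    by_cases h : (k : ℕ) < l <;> simp [h, xzInd]
  have h2 : (if XZZero l w then (1 : ℝ) else 0) =
      ∏ k : Fin (D + q * D), if (k : ℕ) < l then xzInd (w k) else 1 := by
    simp only [h1, Finset.prod_ite_zero, Finset.mem_univ, true_imp_iff, Finset.prod_const_one]
    rfl
  rw [h2, ← (lagEquiv q D).prod_comp, Fintype.prod_prod_type, Finset.prod_comm]
  simp only [lagEquiv_val, windowInd]

theorem prod_lag_eq {q D : ℕ} (K : State m → State m → ℝ) (w : Hist (D + q * D) m) :
    ∏ k : Fin (q * D), K (w ⟨D + k, by lia⟩) (w ⟨k, by lia⟩) =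
      ∏ r : Fin D, ∏ t : Fin q,
        K (w (lagEquiv q D (t.succ, r))) (w (lagEquiv q D (t.castSucc, r))) := by
  rw [← finProdFinEquiv.prod_comp, Fintype.prod_prod_type, Finset.prod_comm]
  refine Finset.prod_congr rfl fun r _ => Finset.prod_congr rfl fun t _ => ?_
  have h1 : (⟨D + (finProdFinEquiv (t, r) : Fin (q * D)), by lia⟩ : Fin (D + q * D)) =
      lagEquiv q D (t.succ, r) := by
    ext
    rw [lagEquiv_val]
    simp only [finProdFinEquiv_apply_val, Fin.val_succ]
    ring
  have h2 : (⟨(finProdFinEquiv (t, r) : Fin (q * D)), by lia⟩ : Fin (D + q * D)) =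
      lagEquiv q D (t.castSucc, r) := by
    ext
    rw [lagEquiv_val]
    simp only [finProdFinEquiv_apply_val, Fin.val_castSucc]
    ring
  rw [h1, h2]

/-- Transitions at lag `D` link only lags of equal residue, and the window indicator is a product
over lags, so the sum splits into `D` chains. -/
theorem sum_window_eq_prod_chainSum (K : State m → State m → ℝ) (q l : ℕ) {D : ℕ}
    (h : Fin D → State m → ℝ) :
    (∑ w : Hist (D + q * D) m, if XZZero l w then
      (∏ k : Fin (q * D), K (w ⟨D + k, by lia⟩) (w ⟨k, by lia⟩)) *
        ∏ r, h r (w (lagEquiv q D (0, r))) else 0) =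
      ∏ r : Fin D, chainSum K q (windowInd D l r) (h r) := by
  simp only [← sum_eq_chainSum]
  rw [← sum_prod_residue (lagEquiv q D)]
  refine Finset.sum_congr rfl fun w _ => ?_
  rw [Finset.prod_mul_distrib, Finset.prod_mul_distrib, ← ite_xzZero_eq_prod, ← prod_lag_eq]
  split_ifs <;> ring

theorem pastWeight_paramOfKernel (hκ : ∀ S s, ∑ x, κ S s x = 1)
    (hcol : ∀ s', ∑ s, jointKernel κ s s' = 1) (q l : ℕ) :
    pastWeight (paramOfKernel e κ) (q * (e + 1)) l =
      (balanceMatrix (paramOfKernel e κ)).det * (Fintype.card (Hist (e + 1) m) : ℝ)⁻¹ *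
        ((∏ r : Fin e, chainSum (jointKernel κ) q (windowInd (e + 1) l r) 1) *
          chainSum (jointKernel κ) q (windowInd (e + 1) l e) 1) := by
  have h := (sum_window_eq_prod_chainSum (jointKernel κ) q l
    fun (_ : Fin (e + 1)) _ => 1).trans (Fin.prod_univ_castSucc _)
  simp only [Fin.val_castSucc, Fin.val_last, Finset.prod_const_one, mul_one] at h
  refine Eq.trans ?_ (congrArg _ h)
  rw [pastWeight, Finset.mul_sum]
  refine Finset.sum_congr rfl fun w _ => ?_
  rw [pathWeight_paramOfKernel hκ hcol, mul_ite, mul_zero]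

/-- The present letter of `X` depends only on lag `e + 1`, the newest letter of class `e`. The other
classes contribute the same factors as in `pastWeight`, which are positive when the kernel is. -/
theorem nextWeight_paramOfKernel (hκ : ∀ S s, ∑ x, κ S s x = 1)
    (hcol : ∀ s', ∑ s, jointKernel κ s s' = 1) (q l : ℕ) :
    nextWeight (paramOfKernel e κ) (q * (e + 1)) l =
      (balanceMatrix (paramOfKernel e κ)).det * (Fintype.card (Hist (e + 1) m) : ℝ)⁻¹ *
        ((∏ r : Fin e, chainSum (jointKernel κ) q (windowInd (e + 1) l r) 1) *
          chainSum (jointKernel κ) q (windowInd (e + 1) l e) fun s => κ Proc.X s 0) := by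
  have h := (sum_window_eq_prod_chainSum (jointKernel κ) q l
    (Fin.snoc (α := fun _ => State m → ℝ) (fun (_ : Fin e) _ => 1)
      fun s => κ Proc.X s 0)).trans (Fin.prod_univ_castSucc _)
  simp only [Fin.prod_univ_castSucc (n := e), Fin.snoc_castSucc, Fin.snoc_last,
    Fin.val_castSucc, Fin.val_last, Finset.prod_const_one, one_mul] at h
  refine Eq.trans ?_ (congrArg _ h)
  rw [nextWeight, Finset.mul_sum]
  refine Finset.sum_congr rfl fun w _ => ?_
  have hidx : lagEquiv q (e + 1) (0, Fin.last e) =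
      (Fin.last e).castLE (Nat.le_add_right (e + 1) (q * (e + 1))) := by
    ext
    rw [lagEquiv_val]
    simp
  rw [pathWeight_paramOfKernel hκ hcol, mul_ite, mul_zero, condPmf_paramOfKernel hκ, hidx,
    mul_assoc]
  rfl

/-- The gap of the subchain at the lags that are multiples of `e + 1`. -/
def lagGap (e : ℕ) (κ : (S : Proc) → State m → Alph m S → ℝ) (q n l : ℕ) : ℝ :=
  chainSum (jointKernel κ) q (windowInd (e + 1) n e) (fun s => κ Proc.X s 0) *
      chainSum (jointKernel κ) q (windowInd (e + 1) l e) 1 -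
    chainSum (jointKernel κ) q (windowInd (e + 1) l e) (fun s => κ Proc.X s 0) *
      chainSum (jointKernel κ) q (windowInd (e + 1) n e) 1

theorem gap_paramOfKernel_ne_zero (hκ : ∀ S s, ∑ x, κ S s x = 1) (hpos : ∀ S s x, 0 < κ S s x)
    (hcol : ∀ s', ∑ s, jointKernel κ s s' = 1) (q l : ℕ)
    (hgap : lagGap e κ q (e + 1 + q * (e + 1)) l ≠ 0) :
    gap (paramOfKernel e κ) (q * (e + 1)) l ≠ 0 := by
  have hdet : (balanceMatrix (paramOfKernel e κ)).det ≠ 0 :=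
    det_balanceMatrix_ne_zero fun S b x => by
      rw [condPmf_paramOfKernel hκ]
      exact hpos _ _ _
  have hcard : (Fintype.card (Hist (e + 1) m) : ℝ)⁻¹ ≠ 0 :=
    inv_ne_zero (by exact_mod_cast Fintype.card_ne_zero)
  have hprod : ∀ n, (∏ r : Fin e, chainSum (jointKernel κ) q (windowInd (e + 1) n r) 1) ≠ 0 := by
    intro n
    refine (Finset.prod_pos fun r _ => chainSum_pos ?_ q (windowInd_nonneg _ _ _) ?_ ?_).ne'
    · exact fun s s' => Finset.prod_pos fun S _ => hpos _ _ _
    · exact fun t => ⟨0, by rw [windowInd_zero]; exact one_pos⟩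
    · exact fun _ => one_pos
  have key : gap (paramOfKernel e κ) (q * (e + 1)) l =
      ((balanceMatrix (paramOfKernel e κ)).det * (Fintype.card (Hist (e + 1) m) : ℝ)⁻¹) ^ 2 *
      (∏ r : Fin e, chainSum (jointKernel κ) q (windowInd (e + 1) (e + 1 + q * (e + 1)) r) 1) *
      (∏ r : Fin e, chainSum (jointKernel κ) q (windowInd (e + 1) l r) 1) *
      lagGap e κ q (e + 1 + q * (e + 1)) l := by
    rw [gap, pastWeight_paramOfKernel hκ hcol, pastWeight_paramOfKernel hκ hcol,
      nextWeight_paramOfKernel hκ hcol, nextWeight_paramOfKernel hκ hcol, lagGap]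
    ring
  rw [key]
  exact mul_ne_zero (mul_ne_zero (mul_ne_zero (pow_ne_zero _ (mul_ne_zero hdet hcard))
    (hprod _)) (hprod _)) hgap

end LagKernel

/-! ### The witness with a hidden, nearly frozen `Y`. -/

/-- The kernel that keeps its letter with probability `p` and otherwise draws a uniform letter. -/
noncomputable def lazyKernel {n : ℕ} (p : ℝ) (a b : Fin (n + 1)) : ℝ :=
  (if b = a then p else 0) + (1 - p) / (n + 1)

theorem sum_lazyKernel_right {n : ℕ} (p : ℝ) (a : Fin (n + 1)) : ∑ b, lazyKernel p a b = 1 := by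
  have : (n : ℝ) + 1 ≠ 0 := by positivity
  simp only [lazyKernel, Finset.sum_add_distrib, Finset.sum_ite_eq', Finset.mem_univ, if_true,
    Finset.sum_const, Finset.card_univ, Fintype.card_fin, nsmul_eq_mul]
  push_cast
  field_simp
  ring

theorem sum_lazyKernel_left {n : ℕ} (p : ℝ) (b : Fin (n + 1)) : ∑ a, lazyKernel p a b = 1 := by
  rw [← sum_lazyKernel_right p b]
  simp only [lazyKernel, eq_comm]

theorem lazyKernel_pos {n : ℕ} {p : ℝ} (h0 : 0 ≤ p) (h1 : p < 1) (a b : Fin (n + 1)) :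
    0 < lazyKernel p a b := by
  have : 0 < (1 - p) / ((n : ℝ) + 1) := div_pos (by linarith) (by positivity)
  unfold lazyKernel
  split_ifs <;> linarith

/-- The probability that `X` keeps its letter, as a function of the letter of `Y`. -/
noncomputable def keepProb {n : ℕ} (y : Fin (n + 1)) : ℝ := if y = 0 then 1 / 2 else 1 / 4

/-- `X` keeps its letter with a probability that depends on `Y`, `Y` is redrawn with probability
`ε`, and the letters of `Z` are independent and uniform. -/
noncomputable def hiddenKernel (ε : ℝ) : (S : Proc) → State m → Alph m S → ℝ
  | Proc.X, s, x => lazyKernel (keepProb (s Proc.Y)) (s Proc.X) x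
  | Proc.Y, s, y => lazyKernel (1 - ε) (s Proc.Y) y
  | Proc.Z, _, _ => ((m Proc.Z : ℝ) + 1)⁻¹

theorem sum_hiddenKernel (ε : ℝ) (S : Proc) (s : State m) : ∑ x, hiddenKernel ε S s x = 1 := by
  rcases S with _ | _ | _
  · exact sum_lazyKernel_right _ _
  · exact sum_lazyKernel_right _ _
  · have : (m Proc.Z : ℝ) + 1 ≠ 0 := by positivity
    simp [hiddenKernel, this]

theorem hiddenKernel_pos {ε : ℝ} (h0 : 0 < ε) (h1 : ε ≤ 1) (S : Proc) (s : State m)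
    (x : Alph m S) : 0 < hiddenKernel ε S s x := by
  rcases S with _ | _ | _
  · refine lazyKernel_pos ?_ ?_ _ _ <;> unfold keepProb <;> split_ifs <;> norm_num
  · exact lazyKernel_pos (by linarith) (by linarith) _ _
  · simp only [hiddenKernel]
    positivity

/-- The joint value with the given letters. -/
def mkState (x : Alph m Proc.X) (y : Alph m Proc.Y) (z : Alph m Proc.Z) : State m
  | Proc.X => x
  | Proc.Y => y
  | Proc.Z => z

theorem sum_state (f : State m → ℝ) : ∑ s, f s = ∑ y, ∑ x, ∑ z, f (mkState x y z) := by
  let E : State m ≃ Alph m Proc.Y × Alph m Proc.X × Alph m Proc.Z :=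
    { toFun := fun s => (s Proc.Y, s Proc.X, s Proc.Z)
      invFun := fun q => mkState q.2.1 q.1 q.2.2
      left_inv := fun s => by funext S; cases S <;> rfl
      right_inv := fun q => rfl }
  rw [← E.symm.sum_comp, Fintype.sum_prod_type]
  simp only [Fintype.sum_prod_type]
  rfl

theorem jointKernel_hiddenKernel (ε : ℝ) (s s' : State m) :
    jointKernel (hiddenKernel ε) s s' =
      lazyKernel (keepProb (s Proc.Y)) (s Proc.X) (s' Proc.X) *
        (lazyKernel (1 - ε) (s Proc.Y) (s' Proc.Y) * ((m Proc.Z : ℝ) + 1)⁻¹) := by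
  have : (Finset.univ : Finset Proc) = {Proc.X, Proc.Y, Proc.Z} := rfl
  rw [jointKernel, this, Finset.prod_insert (by decide), Finset.prod_insert (by decide),
    Finset.prod_singleton]
  rfl

/-- For fixed `y` the lazy kernel of `X` is symmetric, so its columns sum to one; then sum over `y`
and `z`. -/
theorem sum_jointKernel_hiddenKernel (ε : ℝ) (s' : State m) :
    ∑ s, jointKernel (hiddenKernel ε) s s' = 1 := by
  have hz : (m Proc.Z : ℝ) + 1 ≠ 0 := by positivity
  rw [sum_state]
  simp only [jointKernel_hiddenKernel, mkState, Finset.sum_const, Finset.card_univ,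
    Fintype.card_fin, nsmul_eq_mul, ← Finset.mul_sum, ← Finset.sum_mul, sum_lazyKernel_left]
  push_cast
  field_simp

theorem sum_mul_xzInd (f : State m → ℝ) : ∑ s, f s * xzInd s = ∑ y, f (mkState 0 y 0) := by
  rw [sum_state]
  refine Finset.sum_congr rfl fun y _ => ?_
  rw [Finset.sum_eq_single 0, Finset.sum_eq_single 0]
  · simp [xzInd, mkState]
  · intro z _ hz
    simp [xzInd, mkState, hz]
  · simp
  · intro x _ hx
    simp [xzInd, mkState, hx]
  · simp

/-- The probability that the letter `0` of `X` is repeated. -/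
noncomputable def repeatProb (m : Proc → ℕ) (y : Alph m Proc.Y) : ℝ :=
  lazyKernel (n := m Proc.X) (keepProb y) 0 0

/-- At `ε = 0` the letter of `Y` never changes, so only words with constant `y` survive. Each step
repeats the zero of `X` and draws the zero of `Z`. -/
theorem chainSum_xzInd (q : ℕ) (h : State m → ℝ) :
    chainSum (jointKernel (hiddenKernel 0)) q (fun _ => xzInd) h =
      ∑ y, h (mkState 0 y 0) * (repeatProb m y * ((m Proc.Z : ℝ) + 1)⁻¹) ^ q := by
  induction q generalizing h with
  | zero => simp [chainSum, sum_mul_xzInd]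
  | succ q ih =>
    rw [chainSum, ih]
    refine Finset.sum_congr rfl fun y _ => ?_
    have h1 := sum_mul_xzInd fun s => h s * jointKernel (hiddenKernel 0) (mkState 0 y 0) s
    simp only [mul_right_comm _ _ (xzInd _)] at h1
    rw [h1, Finset.sum_eq_single y, jointKernel_hiddenKernel]
    · simp only [mkState, repeatProb, lazyKernel]
      ring_nf
      simp
    · intro y' _ hy'
      simp [jointKernel_hiddenKernel, mkState, lazyKernel, hy']
    · simp

/-- Here the oldest letter is free. Its sum is a column sum, equal to one, so one factor fewer
remains. -/
theorem chainSum_xzInd_init (q : ℕ) (h : State m → ℝ) :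
    chainSum (jointKernel (hiddenKernel 0)) (q + 1)
        (fun t => if t < q + 1 then xzInd else fun _ => 1) h =
      ∑ y, h (mkState 0 y 0) * (repeatProb m y * ((m Proc.Z : ℝ) + 1)⁻¹) ^ q := by
  induction q generalizing h with
  | zero =>
    simp only [chainSum, zero_add, lt_irrefl, if_false, mul_one, Nat.lt_one_iff, if_true, pow_zero]
    rw [Finset.sum_comm]
    simp only [← Finset.mul_sum, sum_jointKernel_hiddenKernel, mul_one, sum_mul_xzInd]
  | succ q ih =>
    rw [chainSum]
    simp only [Nat.add_lt_add_iff_right]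
    rw [ih]
    refine Finset.sum_congr rfl fun y _ => ?_
    have h1 := sum_mul_xzInd fun s => h s * jointKernel (hiddenKernel 0) (mkState 0 y 0) s
    simp only [mul_right_comm _ _ (xzInd _)] at h1
    simp only [Nat.zero_lt_succ, if_true]
    rw [h1, Finset.sum_eq_single y, jointKernel_hiddenKernel]
    · simp only [mkState, repeatProb, lazyKernel]
      ring_nf
      simp
    · intro y' _ hy'
      simp [jointKernel_hiddenKernel, mkState, lazyKernel, hy']
    · simp

theorem repeatProb_zero (m : Proc → ℕ) :
    repeatProb m 0 = 1 / 2 + (1 / 2) / ((m Proc.X : ℝ) + 1) := by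
  simp [repeatProb, lazyKernel, keepProb]
  norm_num

theorem repeatProb_succ (m : Proc → ℕ) (y : Fin (m Proc.Y)) :
    repeatProb m y.succ = 1 / 4 + (3 / 4) / ((m Proc.X : ℝ) + 1) := by
  simp [repeatProb, lazyKernel, keepProb]
  norm_num

theorem inv_lt_repeatProb (hX : 0 < m Proc.X) (y : Alph m Proc.Y) :
    ((m Proc.X : ℝ) + 1)⁻¹ < repeatProb m y := by
  have h1 : ((m Proc.X : ℝ) + 1)⁻¹ < 1 := by
    apply inv_lt_one_of_one_lt₀
    have : (0 : ℝ) < m Proc.X := by exact_mod_cast hX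
    linarith
  refine Fin.cases ?_ (fun k => ?_) y
  · rw [repeatProb_zero, div_eq_mul_inv (1 / 2)]
    linarith
  · rw [repeatProb_succ, div_eq_mul_inv (3 / 4)]
    linarith

/-- The powers of `repeatProb` do not form a geometric sequence after averaging. -/
theorem sum_repeatProb_pow_ne (hX : 0 < m Proc.X) (hY : 0 < m Proc.Y) (p : ℕ) :
    (∑ y, repeatProb m y ^ (p + 2)) * ∑ y, repeatProb m y ^ p -
      (∑ y, repeatProb m y ^ (p + 1)) ^ 2 ≠ 0 := by
  have h1 : ((m Proc.X : ℝ) + 1)⁻¹ < 1 := by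
    apply inv_lt_one_of_one_lt₀
    have : (0 : ℝ) < m Proc.X := by exact_mod_cast hX
    linarith
  have h0 : 0 < ((m Proc.X : ℝ) + 1)⁻¹ := by positivity
  simp only [Fin.sum_univ_succ, repeatProb_zero, repeatProb_succ, Finset.sum_const,
    Finset.card_univ, Fintype.card_fin, nsmul_eq_mul, div_eq_mul_inv _ ((m Proc.X : ℝ) + 1)]
  set u := ((m Proc.X : ℝ) + 1)⁻¹
  have hM : (m Proc.Y : ℝ) ≠ 0 := by exact_mod_cast hY.ne'
  have hne : (1 / 2 + 1 / 2 * u) - (1 / 4 + 3 / 4 * u) ≠ 0 := by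
    have : 0 < (1 / 2 + 1 / 2 * u) - (1 / 4 + 3 / 4 * u) := by linarith
    exact this.ne'
  have ha : (1 / 2 + 1 / 2 * u) ≠ 0 := by positivity
  have hb : (1 / 4 + 3 / 4 * u) ≠ 0 := by positivity
  generalize 1 / 2 + 1 / 2 * u = a at *
  generalize 1 / 4 + 3 / 4 * u = b at *
  -- The defect in Cauchy–Schwarz for the value `a`, taken once, and `b`, taken `m Proc.Y` times.
  have : m Proc.Y * a ^ p * b ^ p * (a - b) ^ 2 ≠ 0 :=
    mul_ne_zero (mul_ne_zero (mul_ne_zero hM (pow_ne_zero _ ha)) (pow_ne_zero _ hb))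
      (pow_ne_zero _ hne)
  convert this using 1
  ring

theorem lagGap_zero_ne_zero (hX : 0 < m Proc.X) {e l : ℕ} (h : 0 < m Proc.Y ∨ l < e + 1) :
    lagGap e (hiddenKernel (m := m) 0) (l / (e + 1))
      (e + 1 + l / (e + 1) * (e + 1)) l ≠ 0 := by
  set q := l / (e + 1) with hq
  have hn : ∀ h : State m → ℝ, chainSum (jointKernel (hiddenKernel 0)) q
      (windowInd (e + 1) (e + 1 + q * (e + 1)) e) h =
      ∑ y, h (mkState 0 y 0) * (repeatProb m y * ((m Proc.Z : ℝ) + 1)⁻¹) ^ q := by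
    intro h
    rw [← chainSum_xzInd]
    refine chainSum_congr _ _ (fun t ht => ?_) h
    funext s
    have : t * (e + 1) ≤ q * (e + 1) := Nat.mul_le_mul_right _ ht
    rw [windowInd, if_pos (by lia)]
  have hl : ∀ h : State m → ℝ, chainSum (jointKernel (hiddenKernel 0)) q
      (windowInd (e + 1) l e) h = chainSum (jointKernel (hiddenKernel 0)) q
        (fun t => if t < q then xzInd else fun _ => 1) h := by
    refine chainSum_congr _ _ (fun t ht => ?_)
    funext s
    -- In class `e` the window of length `l` covers all letters but the oldest, whereas the longer
    -- window covers all `q + 1`.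
    have h1 : t * (e + 1) + e < l ↔ t < q := by
      rw [hq, ← Nat.succ_le_iff (m := t), Nat.le_div_iff_mul_le (Nat.succ_pos e), Nat.succ_mul]
      lia
    simp only [windowInd, h1]
    split_ifs <;> rfl
  have hX0 : ∀ y, hiddenKernel (m := m) 0 Proc.X (mkState 0 y 0) 0 = repeatProb m y := fun y => rfl
  have hz : (m Proc.Z : ℝ) + 1 ≠ 0 := by positivity
  rw [lagGap, hn, hn, hl, hl]
  clear_value q
  -- For `q = 0` the short window misses lag `e + 1` altogether, so `repeatProb` is compared with
  -- the uniform probability of a zero. Otherwise `l ≥ e + 1`, so `Y` has two letters and the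
  -- Cauchy–Schwarz defect applies.
  rcases q with _ | p
  · have h1 : ∀ s : State m, hiddenKernel (m := m) 0 Proc.X s 0 =
      lazyKernel (keepProb (s Proc.Y)) (s Proc.X) 0 := fun s => rfl
    simp only [chainSum, lt_irrefl, if_false, mul_one, pow_zero, hX0, Pi.one_apply]
    simp only [h1]
    rw [sum_state, sum_state]
    simp only [mkState, Finset.sum_const, Finset.card_univ, Fintype.card_fin, nsmul_eq_mul,
      ← Finset.mul_sum, sum_lazyKernel_left, mul_one]
    push_cast
    have h2 : ∑ y : Alph m Proc.Y, ((m Proc.X : ℝ) + 1)⁻¹ < ∑ y, repeatProb m y :=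
      Finset.sum_lt_sum_of_nonempty Finset.univ_nonempty fun y _ => inv_lt_repeatProb hX y
    simp only [Finset.sum_const, Finset.card_univ, Fintype.card_fin, nsmul_eq_mul] at h2
    push_cast at h2
    rw [← div_eq_mul_inv, div_lt_iff₀ (by positivity)] at h2
    have h3 : 0 < ((m Proc.Y : ℝ) + 1) * ((m Proc.Z : ℝ) + 1) *
        ((∑ y, repeatProb m y) * ((m Proc.X : ℝ) + 1) - ((m Proc.Y : ℝ) + 1)) :=
      mul_pos (by positivity) (by linarith)
    refine ne_of_gt (lt_of_lt_of_eq h3 ?_)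
    ring
  · have hY : 0 < m Proc.Y := by
      refine h.resolve_right fun hle => ?_
      rw [Nat.div_eq_of_lt hle] at hq
      lia
    rw [chainSum_xzInd_init, chainSum_xzInd_init]
    simp only [hX0, Pi.one_apply, one_mul, mul_pow, ← mul_assoc, ← pow_succ', ← Finset.sum_mul]
    have h1 := mul_ne_zero (sum_repeatProb_pow_ne hX hY p)
      (pow_ne_zero (2 * p + 1) (inv_ne_zero hz))
    convert h1 using 1
    ring

theorem exists_gap_ne_zero {d : ℕ} (l : ℕ) (hd : 0 < d) (hX : 0 < m Proc.X)
    (h : 0 < m Proc.Y ∨ l < d) : ∃ j : ℕ, l ≤ d + j ∧ ∃ θ : Param d m, gap θ j l ≠ 0 := by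
  obtain ⟨e, rfl⟩ : ∃ e, d = e + 1 := ⟨d - 1, by lia⟩
  -- This makes `d + j` the first multiple of `d` greater than `l`.
  refine ⟨l / (e + 1) * (e + 1), ?_, ?_⟩
  · have h1 := Nat.div_add_mod l (e + 1)
    have h2 := Nat.mod_lt l (Nat.succ_pos e)
    rw [mul_comm] at h1
    lia
  have hK : ∀ s s' : State m, Continuous fun ε : ℝ => jointKernel (hiddenKernel ε) s s' := by
    intro s s'
    simp only [jointKernel_hiddenKernel, lazyKernel]
    refine continuous_const.mul (Continuous.mul (Continuous.add ?_ ?_) continuous_const)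
    · split_ifs <;> fun_prop
    · fun_prop
  have hcont : Continuous fun ε : ℝ => lagGap e (hiddenKernel (m := m) ε) (l / (e + 1))
      (e + 1 + l / (e + 1) * (e + 1)) l := by
    have hc : ∀ s : State m, Continuous fun ε : ℝ => hiddenKernel ε Proc.X s 0 := fun s =>
      continuous_const
    exact ((continuous_chainSum hK _ _ hc).mul
      (continuous_chainSum hK _ _ fun s => continuous_const)).sub
      ((continuous_chainSum hK _ _ hc).mul
        (continuous_chainSum hK _ _ fun s => continuous_const))
  -- At `ε = 0` some transition probabilities may vanish. A small `ε > 0` makes all of them positive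
  -- and keeps `lagGap` nonzero.
  have h1 := (hcont.continuousAt (x := 0)).eventually_ne (lagGap_zero_ne_zero hX h)
  have h2 : ∀ᶠ ε : ℝ in nhdsWithin 0 (Ioi 0), 0 < ε ∧ ε < 1 :=
    Ioo_mem_nhdsGT one_pos
  obtain ⟨ε, hε, h0, h1⟩ := ((h1.filter_mono nhdsWithin_le_nhds).and h2).exists
  exact ⟨paramOfKernel e (hiddenKernel ε), gap_paramOfKernel_ne_zero (sum_hiddenKernel ε)
    (hiddenKernel_pos h0 h1.le) (sum_jointKernel_hiddenKernel ε) _ _ hε⟩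

end MarkovNet

theorem mainTheorem7 (d : ℕ) (m : MarkovNet.Proc → ℕ) :
    MeasureTheory.volume
      {θ : MarkovNet.Param d m |
        ∃ P : MeasureTheory.Measure (MarkovNet.Path m), MarkovNet.IsLawOf θ P ∧
          ∃ l : ℕ, 0 < l ∧ MarkovNet.IsCondMarkov P l ∧
            ∃ i : ℤ, ¬ MarkovNet.WindowDSeparates d P l i} = 0 := by
  exact MarkovNet.volume_eq_zero_of_gap_ne_zero MarkovNet.exists_gap_ne_zero
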